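/- Let $n\ge 0$ and let $S=\mathrm{Co}\{p_0,\dots,p_n\}\subseteq\mathbb{R}^n$ be a regular simplex with vertices $p_0,\dots,p_n$ and center $v$; write $N=\{0,\dots,n\}$. Here $\mathrm{Co}$ denotes the convex hull, $\mathrm{ri}$ the relative interior, and $\mathrm{Ex}$ the set of extreme points. **Lattices.** $\mathbf{B}(n+1)$ is the Boolean lattice of all subsets of $N$, and $\mathrm{Sub}_\wedge(\mathbf{B}(n+1))$ is the lattice, under inclusion, of all its meet-subsemilattices that contain the top element, i.e. families of subsets of $N$ that contain $N$ and are closed under binary intersection. For $X\subseteq\mathbb{R}^n$, $\mathrm{Co}(\mathbb{R}^n,X)=\{Y\subseteq\mathbb{R}^n : Y=\mathrm{Co}(Y)\cap X\}$ is the lattice, under inclusion, of convex sets relative to $X$. **The map $\varphi$.** For $t\subseteq N$ let $\psi(t)=\mathrm{ri}\,\mathrm{Co}\{p_i : i\in N\setminus t\}$ (so $\psi(N)=\varnothing$ and $\psi(N\setminus\{i\})=\{p_i\}$), and let $\varphi(\mathcal S)=\bigcup_{t\in\mathcal S}\psi(t)$ for $\mathcal S\in\mathrm{Sub}_\wedge(\mathbf{B}(n+1))$.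 **The set $X$.** For $A\subseteq N$ let $S_A=\mathrm{Co}\{p_i : i\in A\}$, and for $r\ge 0$ let $S_A^{r}$ be the set of points of $S_A$ whose distance to the affine hull of $\{p_j : j\in A\setminus\{i\}\}$ is at least $r$ for every $i\in A$; for small $r$ this is the smaller simplex inside $S_A$ whose facets are parallel to the facets of $S_A$ and at distance $r$ from them. (If $|A|\le 1$ there are no facets, and $S_A^{0}=S_A$.) Call $(\lambda_0,\dots,\lambda_n)$ an *admissible sequence* if * $\lambda_k>0$ for all $k<n$, and $\lambda_n=0$; * if $n>0$, then $\lambda_0$ is smaller than the inradius of $S$; * for every $k$ with $k+1<n$, every $A\subseteq N$ with $|A|=n+1-k$ and all distinct $i,j\in A$, $$S_A^{\lambda_k}\subseteq \mathrm{ri}\,\mathrm{Co}\bigl(S_{A\setminus\{i\}}^{\lambda_{k+1}}\cup S_{A\setminus\{j\}}^{\lambda_{k+1}}\bigr).$$ For an admissible sequence put $P_A=S_A^{\lambda_k}$ with $k=n+1-|A|$, for nonempty $A\subseteq N$, and $$X=\{v\}\cup\bigcup\{\mathrm{Ex}\,P_A : \varnothing\ne A\subsetneq N\}.$$ **Proposition.**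 Admissible sequences exist; moreover, if $n>0$, every positive real number smaller than the inradius of $S$ is the first term $\lambda_0$ of an admissible sequence. For every admissible sequence, the set $X$ is finite and the map $\mathcal S\mapsto\varphi(\mathcal S)\cap X$ is a lattice embedding (an injective map preserving binary meets and joins) of $\mathrm{Sub}_\wedge(\mathbf{B}(n+1))$ into $\mathrm{Co}(\mathbb{R}^n,X)$. -/

import Mathlib

/-- `Sub_∧(L)`: the meet-subsemilattices of `L` that contain the top element of `L`
(the empty meet), ordered by inclusion. -/
def MeetSub (L : Type*) [SemilatticeInf L] [OrderTop L] : Type _ :=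
  {S : Set L // ⊤ ∈ S ∧ InfClosed S}

namespace MeetSub

variable {L : Type*} [SemilatticeInf L] [OrderTop L]

instance : PartialOrder (MeetSub L) := Subtype.partialOrder _

/-- The lattice of meet-subsemilattices under inclusion. -/
instance : Lattice (MeetSub L) :=
  { (inferInstance : PartialOrder (MeetSub L)) with
    inf := fun S T => ⟨S.1 ∩ T.1, ⟨S.2.1, T.2.1⟩, S.2.2.inter T.2.2⟩
    inf_le_left := fun _ _ _ hx => hx.1
    inf_le_right := fun _ _ _ hx => hx.2
    le_inf := fun _ _ _ h₁ h₂ _ hx => ⟨h₁ hx, h₂ hx⟩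
    sup := fun S T => ⟨{x | ∃ a ∈ S.1, ∃ b ∈ T.1, a ⊓ b = x},
      ⟨⊤, S.2.1, ⊤, T.2.1, inf_idem _⟩, by
        rintro _ ⟨a, ha, b, hb, rfl⟩ _ ⟨c, hc, d, hd, rfl⟩
        exact ⟨a ⊓ c, S.2.2 ha hc, b ⊓ d, T.2.2 hb hd, inf_inf_inf_comm a c b d⟩⟩
    le_sup_left := fun _ T x hx => ⟨x, hx, ⊤, T.2.1, inf_top_eq x⟩
    le_sup_right := fun S _ x hx => ⟨⊤, S.2.1, x, hx, top_inf_eq x⟩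
    sup_le := by
      rintro S T U h₁ h₂ _ ⟨a, ha, b, hb, rfl⟩
      exact U.2.2 (h₁ ha) (h₂ hb) }

end MeetSub

/-- `Co(E, X)`: the subsets `Y` of `E` with `Y = Co(Y) ∩ X`, ordered by inclusion. -/
def RelConvex {E : Type*} [AddCommGroup E] [Module ℝ E] (X : Set E) : Type _ :=
  {Y : Set E // Y = convexHull ℝ Y ∩ X}

namespace RelConvex

variable {E : Type*} [AddCommGroup E] [Module ℝ E] {X : Set E}

instance : PartialOrder (RelConvex X) := Subtype.partialOrder _

theorem subset (Y : RelConvex X) : Y.1 ⊆ X := fun x hx => by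
  rw [Y.2] at hx
  exact hx.2

/-- The lattice of relatively convex sets under inclusion: the meet is the intersection, and the
join of `Y` and `Z` is `Co(Y ∪ Z) ∩ X`. -/
instance : Lattice (RelConvex X) :=
  { (inferInstance : PartialOrder (RelConvex X)) with
    inf := fun Y Z => ⟨Y.1 ∩ Z.1, by
      apply Set.Subset.antisymm
      · exact fun x hx => ⟨subset_convexHull ℝ _ hx, subset Y hx.1⟩
      · rintro x ⟨hx, hX⟩
        constructor
        · rw [Y.2]
          exact ⟨convexHull_mono Set.inter_subset_left hx, hX⟩
        · rw [Z.2]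
          exact ⟨convexHull_mono Set.inter_subset_right hx, hX⟩⟩
    inf_le_left := fun _ _ _ hx => hx.1
    inf_le_right := fun _ _ _ hx => hx.2
    le_inf := fun _ _ _ h₁ h₂ _ hx => ⟨h₁ hx, h₂ hx⟩
    sup := fun Y Z => ⟨convexHull ℝ (Y.1 ∪ Z.1) ∩ X, by
      apply Set.Subset.antisymm
      · exact fun x hx => ⟨subset_convexHull ℝ _ hx, hx.2⟩
      · exact fun x hx => ⟨convexHull_min Set.inter_subset_left (convex_convexHull ℝ _) hx.1, hx.2⟩⟩
    le_sup_left := fun Y _ _ hx => ⟨subset_convexHull ℝ _ (Or.inl hx), subset Y hx⟩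
    le_sup_right := fun _ Z _ hx => ⟨subset_convexHull ℝ _ (Or.inr hx), subset Z hx⟩
    sup_le := by
      intro Y Z W h₁ h₂ x hx
      rw [W.2]
      exact ⟨convexHull_mono (Set.union_subset h₁ h₂) hx.1, hx.2⟩ }

end RelConvex

namespace Shrunken

variable {n : ℕ} (s : Affine.Simplex ℝ (EuclideanSpace ℝ (Fin n)) n)

/-- The affine hull of the vertices `p_i`, `i ∈ A`. -/
noncomputable def faceSpan (A : Finset (Fin (n + 1))) : AffineSubspace ℝ (EuclideanSpace ℝ (Fin n)) :=
  affineSpan ℝ (s.points '' A)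

/-- The face `S_A = Co {p_i : i ∈ A}` of the simplex. -/
def face (A : Finset (Fin (n + 1))) : Set (EuclideanSpace ℝ (Fin n)) :=
  convexHull ℝ (s.points '' A)

/-- `ψ(t)`: the relative interior of `Co {p_i : i ∉ t}`. It is empty for `t = {0, …, n}`, and it
is `{p_i}` when `i` is the only index outside `t`, because the relative interior of a one-point
set is that set. -/
def psi (t : Finset (Fin (n + 1))) : Set (EuclideanSpace ℝ (Fin n)) :=
  intrinsicInterior ℝ (face s tᶜ)

/-- `φ(S)`, the union of the `ψ(t)` for `t ∈ S`. -/
def phi (S : MeetSub (Finset (Fin (n + 1)))) : Set (EuclideanSpace ℝ (Fin n)) :=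
  ⋃ t ∈ S.1, psi s t

/-- `S_A^r`: the concentric copy of the face `S_A` inside `S_A` whose facets are parallel to those
of `S_A`, at distance `r` from them; that is, the points of `S_A` at distance at least `r` from
every facet of `S_A`. A one-point face has no facets; only `r = 0` is used for it, and `S_A^0` is
`S_A` (`Metric.infDist` to the empty set is `0`). -/
def shrink (A : Finset (Fin (n + 1))) (r : ℝ) : Set (EuclideanSpace ℝ (Fin n)) :=
  {x ∈ face s A | ∀ i ∈ A, r ≤ Metric.infDist x (faceSpan s (A.erase i))}

/-- The center `v` of the simplex. -/
noncomputable def center : EuclideanSpace ℝ (Fin n) := Finset.univ.centroid ℝ s.points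

/-- `r` is positive and smaller than the distance from the center of the simplex to its facets. -/
def IsSmall (r : ℝ) : Prop :=
  0 < r ∧ ∀ i, r < Metric.infDist (center s) (faceSpan s (Finset.univ.erase i))

/-- The sequences `λ_0, …, λ_n` of the construction: `λ_k > 0` for `k < n`, `λ_n = 0`, `λ_0` is
small, and `S_A^{λ_k}` lies in the relative interior of
`Co (S_{A ∖ {i}}^{λ_{k+1}} ∪ S_{A ∖ {j}}^{λ_{k+1}})` whenever `|A| = n + 1 - k > 2` and `i ≠ j`
are in `A`. The values `l k` with `k > n` are irrelevant. For `n = 0` the only value is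
`λ_0 = λ_n = 0`. -/
structure IsShrinkSeq (l : ℕ → ℝ) : Prop where
  pos : ∀ k < n, 0 < l k
  last : l n = 0
  small : 0 < n → IsSmall s (l 0)
  step : ∀ k, k + 1 < n → ∀ A : Finset (Fin (n + 1)), A.card + k = n + 1 →
    ∀ i ∈ A, ∀ j ∈ A, i ≠ j →
      shrink s A (l k) ⊆ intrinsicInterior ℝ (convexHull ℝ
        (shrink s (A.erase i) (l (k + 1)) ∪ shrink s (A.erase j) (l (k + 1))))

/-- `P_A = S_A^{λ_k}` with `|A| + k = n + 1` (for empty `A` it is empty). -/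
def P (l : ℕ → ℝ) (A : Finset (Fin (n + 1))) : Set (EuclideanSpace ℝ (Fin n)) :=
  shrink s A (l (n + 1 - A.card))

/-- The set `X` consisting of the center `v` and the extreme points of the `P_A`, where `A` runs
over the proper subsets of the index set. -/
def X (l : ℕ → ℝ) : Set (EuclideanSpace ℝ (Fin n)) :=
  {center s} ∪ ⋃ A ∈ {A : Finset (Fin (n + 1)) | A ⊂ Finset.univ}, (P s l A).extremePoints ℝ

end Shrunken

/-! In barycentric coordinates everything becomes combinatorial. The distance from a point of `S_A`
to the facet opposite `p_i` is its `i`-th coordinate times the height of `S_A`, and by regularity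
this height depends only on `|A|`. So `P_A` consists of the points whose coordinates vanish off `A`
and are at least `μ |A|` on `A`. Every point of `P_A` has support exactly `A`, hence lies in `φ(S)`
iff `Aᶜ ∈ S` (`mem_phi_iff`). Since each point of `X` lies in some `P_A`, and each nonempty `A` has
a point of `X` in `P_A`, meets and injectivity follow.

For joins, `φ(S ⊔ T)` is convex (`convex_phi`), which gives one inclusion. The other needs `P_{A ∪
B} ⊆ Co(Ex P_A ∪ Ex P_B)` for incomparable `A`, `B` (`P_union_subset`). A point with all coordinates
on `A ∪ B` at least `c > 0` splits into points of `S_A` and `S_B` with the same bound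
(`part_union_subset`), and admissibility makes `μ` monotone, so the bound for `A ∪ B` suffices for
`A` and `B`. -/

/-! ### Relative interiors. -/

section IntrinsicInterior

variable {V : Type*} [NormedAddCommGroup V] [NormedSpace ℝ V]

theorem mem_intrinsicInterior_of_isOpen {T W : Set V} {x : V} (hW : IsOpen W) (hx : x ∈ W)
    (hT : x ∈ T) (h : W ∩ affineSpan ℝ T ⊆ T) : x ∈ intrinsicInterior ℝ T := by
  refine mem_intrinsicInterior.2 ⟨⟨x, subset_affineSpan ℝ T hT⟩, ?_, rfl⟩
  refine mem_interior.2 ⟨Subtype.val ⁻¹' W, ?_, hW.preimage continuous_subtype_val, hx⟩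
  exact fun y hy => h ⟨hy, y.2⟩

/-- The segment from `y` to `x` can be prolonged slightly beyond `x` inside `T`; if `f x ≤ 0 < f y`,
then `f` would be negative there. -/
theorem AffineMap.pos_of_mem_intrinsicInterior {T : Set V} (f : V →ᵃ[ℝ] ℝ)
    (hf : ∀ z ∈ T, 0 ≤ f z) {x y : V} (hx : x ∈ intrinsicInterior ℝ T) (hy : y ∈ T)
    (hfy : 0 < f y) : 0 < f x := by
  obtain ⟨x', hx', rfl⟩ := mem_intrinsicInterior.1 hx
  have hmem : ∀ t : ℝ, AffineMap.lineMap (x' : V) y t ∈ affineSpan ℝ T := fun t =>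
    AffineMap.lineMap_mem t x'.2 (subset_affineSpan ℝ T hy)
  let g : ℝ → affineSpan ℝ T := fun t => ⟨AffineMap.lineMap (x' : V) y t, hmem t⟩
  have hg : Continuous g := by
    refine Continuous.subtype_mk ?_ _
    exact AffineMap.lineMap_continuous
  have hg0 : g 0 = x' := Subtype.ext (AffineMap.lineMap_apply_zero _ _)
  have hev : ∀ᶠ t in nhds (0 : ℝ), g t ∈ interior ((↑) ⁻¹' T : Set (affineSpan ℝ T)) :=
    hg.continuousAt.eventually_mem (by rw [hg0]; exact isOpen_interior.mem_nhds hx')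
  obtain ⟨ε, hε, hb⟩ := Metric.eventually_nhds_iff.1 hev
  have h1 : g (-(ε / 2)) ∈ interior ((↑) ⁻¹' T : Set (affineSpan ℝ T)) := by
    apply hb
    rw [Real.dist_eq, sub_zero, abs_neg, abs_of_pos (by positivity)]
    linarith
  have h3 : g (-(ε / 2)) ∈ ((↑) ⁻¹' T : Set (affineSpan ℝ T)) := interior_subset h1
  have h2 : 0 ≤ f (AffineMap.lineMap (x' : V) y (-(ε / 2))) := hf _ h3
  rw [AffineMap.apply_lineMap, AffineMap.lineMap_apply_ring'] at h2
  nlinarith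

end IntrinsicInterior

/-! ### Truncated simplices in barycentric coordinates. -/

namespace AffineBasis

variable {ι V : Type*} [NormedAddCommGroup V] [NormedSpace ℝ V]
  (b : AffineBasis ι ℝ V)

/-- The points whose barycentric coordinates vanish outside `A` and are at least `c` on `A`. -/
def part (A : Finset ι) (c : ℝ) : Set V :=
  {x | (∀ i ∉ A, b.coord i x = 0) ∧ ∀ i ∈ A, c ≤ b.coord i x}

variable {b} {A B : Finset ι} {c d : ℝ} {x y : V}

theorem coord_combo {s t : ℝ} (hst : s + t = 1) (i : ι) (x y : V) :
    b.coord i (s • x + t • y) = s * b.coord i x + t * b.coord i y := by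
  simpa using Convex.combo_affine_apply (f := b.coord i) hst (x := x) (y := y)

theorem convex_part : Convex ℝ (b.part A c) := by
  intro x hx y hy s t hs ht hst
  refine ⟨fun i hi => ?_, fun i hi => ?_⟩
  · rw [coord_combo hst, hx.1 i hi, hy.1 i hi]; simp
  · rw [coord_combo hst]
    have h1 := mul_le_mul_of_nonneg_left (hx.2 i hi) hs
    have h2 := mul_le_mul_of_nonneg_left (hy.2 i hi) ht
    calc c = s * c + t * c := by rw [← add_mul, hst, one_mul]
      _ ≤ _ := add_le_add h1 h2

theorem coord_sum_smul {κ : Type*} {s : Finset κ} {w : κ → ℝ} (hw : ∑ k ∈ s, w k = 1)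
    (p : κ → V) (i : ι) :
    b.coord i (∑ k ∈ s, w k • p k) = ∑ k ∈ s, w k * b.coord i (p k) := by
  rw [← Finset.affineCombination_eq_linear_combination s p w hw,
    Finset.map_affineCombination s p w hw,
    Finset.affineCombination_eq_linear_combination s _ w hw]
  simp

theorem coord_eq_zero_of_mem_affineSpan {T : Set V} {i : ι} (hT : ∀ y ∈ T, b.coord i y = 0)
    (hx : x ∈ affineSpan ℝ T) : b.coord i x = 0 := by
  have h : affineSpan ℝ T ≤ (affineSpan ℝ {(0 : ℝ)}).comap (b.coord i) := by
    rw [affineSpan_le]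
    intro y hy
    simp [hT y hy]
  simpa using h hx

theorem part_anti (h : c ≤ d) : b.part A d ⊆ b.part A c :=
  fun _ hx => ⟨hx.1, fun i hi => h.trans (hx.2 i hi)⟩

variable [Fintype ι]

theorem sum_coord_of_mem_part (hx : x ∈ b.part A c) : ∑ i ∈ A, b.coord i x = 1 := by
  rw [← b.sum_coord_apply_eq_one x]
  exact Finset.sum_subset A.subset_univ fun i _ hi => hx.1 i hi

theorem nonempty_of_mem_part (hx : x ∈ b.part A c) : A.Nonempty := by
  rw [Finset.nonempty_iff_ne_empty]
  rintro rfl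
  simpa using sum_coord_of_mem_part hx

theorem part_empty : b.part ∅ c = ∅ :=
  Set.eq_empty_of_forall_notMem fun _ hx => by simpa using nonempty_of_mem_part hx

variable (b) in
theorem exists_coord_eq (w : ι → ℝ) (hw : ∑ i, w i = 1) : ∃ x, ∀ i, b.coord i x = w i :=
  ⟨Finset.univ.affineCombination ℝ b w, fun i =>
    b.coord_apply_combination_of_mem (Finset.mem_univ i) hw⟩

/-- A nondegenerate `b.part A c` is the simplex with vertices `q i`, `i ∈ A`. -/
theorem exists_finite_part_eq_convexHull (hc : c * A.card < 1) :
    ∃ q : ι → V, (∀ i ∈ A, q i ∈ b.part A c) ∧ (∀ i ∈ A, ∀ j ∈ A, j ≠ i → b.coord j (q i) = c) ∧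
      b.part A c = convexHull ℝ (q '' A) := by
  classical
  -- The mass left after giving `c` to each index of `A`; the vertex `q i` puts all of it on `i`.
  set e : ℝ := 1 - c * A.card with he
  have he0 : 0 < e := by linarith
  have hex : ∀ i, ∃ x, i ∈ A → ∀ j, b.coord j x =
      (if j ∈ A then c else 0) + if j = i then e else 0 := by
    intro i
    by_cases hi : i ∈ A
    · obtain ⟨x, hx⟩ := b.exists_coord_eq
        (fun j => (if j ∈ A then c else 0) + if j = i then e else 0) (by
          rw [Finset.sum_add_distrib, Finset.sum_ite_mem, Finset.sum_ite_eq']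
          simp [he]; ring)
      exact ⟨x, fun _ => hx⟩
    · exact ⟨0, fun h => absurd h hi⟩
  choose q hq using hex
  have hqm : ∀ i ∈ A, q i ∈ b.part A c := by
    refine fun i hi => ⟨fun j hj => ?_, fun j hj => ?_⟩
    · rw [hq i hi, if_neg hj, if_neg (by rintro rfl; exact hj hi), add_zero]
    · rw [hq i hi, if_pos hj]
      split_ifs <;> linarith
  refine ⟨q, hqm, fun i hi j hj hij => by rw [hq i hi, if_pos hj, if_neg hij, add_zero], ?_⟩
  apply Set.Subset.antisymm
  · intro x hx
    have hs : ∑ i ∈ A, (b.coord i x - c) / e = 1 := by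
      rw [← Finset.sum_div, Finset.sum_sub_distrib, sum_coord_of_mem_part hx, Finset.sum_const,
        nsmul_eq_mul, mul_comm, ← he, div_self he0.ne']
    have hx' : x = ∑ i ∈ A, ((b.coord i x - c) / e) • q i := by
      refine b.ext_elem fun j => ?_
      rw [coord_sum_smul hs, Finset.sum_congr rfl fun i hi => by rw [hq i hi j]]
      simp_rw [mul_add, Finset.sum_add_distrib]
      rw [← Finset.sum_mul, hs, one_mul]
      by_cases hj : j ∈ A
      · simp only [if_pos hj, mul_ite, mul_zero, Finset.sum_ite_eq]
        field_simp; ring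
      · simp [hj, hx.1 j hj]
    rw [hx']
    refine (convex_convexHull ℝ _).sum_mem (fun i hi => ?_) hs fun i hi =>
      subset_convexHull ℝ _ (Set.mem_image_of_mem q hi)
    exact div_nonneg (sub_nonneg.2 (hx.2 i hi)) he0.le
  · refine convexHull_min ?_ convex_part
    rintro _ ⟨i, hi, rfl⟩
    exact hqm i hi

theorem part_zero_eq_convexHull : b.part A 0 = convexHull ℝ (b '' A) := by
  classical
  apply Set.Subset.antisymm
  · intro x hx
    have hs := sum_coord_of_mem_part hx
    have hx' : x = ∑ i ∈ A, b.coord i x • b i := by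
      refine b.ext_elem fun j => ?_
      rw [coord_sum_smul hs]
      by_cases hj : j ∈ A
      · simp [b.coord_apply, hj]
      · simp [b.coord_apply, hj, hx.1 j hj]
    rw [hx']
    exact (convex_convexHull ℝ _).sum_mem hx.2 hs fun i hi =>
      subset_convexHull ℝ _ (Set.mem_image_of_mem b hi)
  · refine convexHull_min ?_ convex_part
    rintro _ ⟨i, hi, rfl⟩
    refine ⟨fun j hj => b.coord_apply_ne (by rintro rfl; exact hj hi), fun j _ => ?_⟩
    rw [b.coord_apply]; split_ifs <;> norm_num

theorem isCompact_part (hc : c * A.card < 1) : IsCompact (b.part A c) := by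
  obtain ⟨q, -, -, h⟩ := exists_finite_part_eq_convexHull (b := b) hc
  rw [h]
  exact (A.finite_toSet.image q).isCompact_convexHull ℝ

theorem finite_extremePoints_part (hc : c * A.card < 1) :
    ((b.part A c).extremePoints ℝ).Finite := by
  obtain ⟨q, -, -, h⟩ := exists_finite_part_eq_convexHull (b := b) hc
  exact (A.finite_toSet.image q).subset (h ▸ extremePoints_convexHull_subset)

/-- Krein–Milman; finitely many extreme points make the closure superfluous. -/
theorem convexHull_extremePoints_part (hc : c * A.card < 1) :
    convexHull ℝ ((b.part A c).extremePoints ℝ) = b.part A c := by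
  have h := closure_convexHull_extremePoints (isCompact_part (b := b) hc) convex_part
  rwa [((finite_extremePoints_part hc).isCompact_convexHull ℝ).isClosed.closure_eq] at h

theorem nonempty_extremePoints_part (hc : c * A.card < 1) (hA : A.Nonempty) :
    ((b.part A c).extremePoints ℝ).Nonempty := by
  obtain ⟨q, hq, -⟩ := exists_finite_part_eq_convexHull (b := b) hc
  obtain ⟨i, hi⟩ := hA
  exact (isCompact_part hc).extremePoints_nonempty ⟨q i, hq i hi⟩

/-- Write `x = s • y + t • z`, where `y` and `z` keep the coordinates of `x` on `A ∩ B`, while those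
on `A \ B` are divided by `s` to form `y` and those on `B \ A` by `t` to form `z`. The weights are
proportional to the masses of `A \ B` and `B \ A`, positive by incomparability and `c > 0`. Division
by a weight below `1` only raises a coordinate, so the bound `c` survives. -/
theorem part_union_subset [DecidableEq ι] (hc : 0 < c) (hAB : ¬ A ⊆ B) (hBA : ¬ B ⊆ A) :
    b.part (A ∪ B) c ⊆ convexHull ℝ (b.part A c ∪ b.part B c) := by
  intro x hx
  have hpos : ∀ i ∈ A ∪ B, 0 < b.coord i x := fun i hi => hc.trans_le (hx.2 i hi)
  set α := ∑ i ∈ A \ B, b.coord i x with hα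
  set β := ∑ i ∈ B \ A, b.coord i x with hβ
  set γ := ∑ i ∈ A ∩ B, b.coord i x with hγ
  have hα0 : 0 < α := Finset.sum_pos
    (fun i hi => hpos i (Finset.mem_union_left _ (Finset.mem_sdiff.1 hi).1))
    (Finset.sdiff_nonempty.2 hAB)
  have hβ0 : 0 < β := Finset.sum_pos
    (fun i hi => hpos i (Finset.mem_union_right _ (Finset.mem_sdiff.1 hi).1))
    (Finset.sdiff_nonempty.2 hBA)
  have hsum : α + β + γ = 1 := by
    rw [← sum_coord_of_mem_part hx, ← Finset.sdiff_union_inter A B, hα, hβ, hγ]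
    have h1 : A \ B ∪ A ∩ B ∪ B = (A \ B ∪ A ∩ B) ∪ (B \ A) := by ext; simp; tauto
    rw [h1, Finset.sum_union, Finset.sum_union]
    · ring
    · rw [Finset.disjoint_left]; intro i; simp; tauto
    · rw [Finset.disjoint_left]; intro i; simp; tauto
  set s := α / (α + β) with hs
  set t := β / (α + β) with ht
  have hs0 : 0 < s := by positivity
  have ht0 : 0 < t := by positivity
  have hst : s + t = 1 := by rw [hs, ht]; field_simp
  obtain ⟨y, hy⟩ := b.exists_coord_eq
    (fun i => if i ∈ A then if i ∈ B then b.coord i x else b.coord i x / s else 0) (by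
      rw [Finset.sum_ite_mem, Finset.univ_inter, Finset.sum_ite, Finset.filter_mem_eq_inter,
        Finset.filter_notMem_eq_sdiff, ← Finset.sum_div, ← hγ, ← hα, hs]
      field_simp; linarith)
  obtain ⟨z, hz⟩ := b.exists_coord_eq
    (fun i => if i ∈ B then if i ∈ A then b.coord i x else b.coord i x / t else 0) (by
      rw [Finset.sum_ite_mem, Finset.univ_inter, Finset.sum_ite, Finset.filter_mem_eq_inter,
        Finset.filter_notMem_eq_sdiff, ← Finset.sum_div, Finset.inter_comm, ← hγ, ← hβ, ht]
      field_simp; linarith)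
  have hyA : y ∈ b.part A c := by
    refine ⟨fun i hi => by rw [hy, if_neg hi], fun i hi => ?_⟩
    have hi' := Finset.mem_union_left B hi
    rw [hy, if_pos hi]
    split_ifs
    · exact hx.2 i hi'
    · exact (hx.2 i hi').trans (le_div_self (hpos i hi').le hs0 (by linarith))
  have hzB : z ∈ b.part B c := by
    refine ⟨fun i hi => by rw [hz, if_neg hi], fun i hi => ?_⟩
    have hi' := Finset.mem_union_right A hi
    rw [hz, if_pos hi]
    split_ifs
    · exact hx.2 i hi'
    · exact (hx.2 i hi').trans (le_div_self (hpos i hi').le ht0 (by linarith))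
  have hxe : x = s • y + t • z := by
    refine b.ext_elem fun i => ?_
    rw [coord_combo hst, hy, hz]
    by_cases hA : i ∈ A <;> by_cases hB : i ∈ B
    · simp only [hA, hB, if_true]; rw [← add_mul, hst, one_mul]
    · simp only [hA, hB, if_true, if_false]; field_simp; ring
    · simp only [hA, hB, if_true, if_false]; field_simp; ring
    · simp only [hA, hB, if_false]; rw [hx.1 i (by simp [hA, hB])]; ring
  rw [hxe]
  have hyT : y ∈ convexHull ℝ (b.part A c ∪ b.part B c) := subset_convexHull ℝ _ (Or.inl hyA)
  have hzT : z ∈ convexHull ℝ (b.part A c ∪ b.part B c) := subset_convexHull ℝ _ (Or.inr hzB)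
  exact convex_convexHull ℝ _ hyT hzT hs0.le ht0.le hst

theorem intrinsicInterior_part_zero :
    intrinsicInterior ℝ (b.part A 0) =
      {x | (∀ i ∉ A, b.coord i x = 0) ∧ ∀ i ∈ A, 0 < b.coord i x} := by
  classical
  apply Set.Subset.antisymm
  · intro x hx
    refine ⟨(intrinsicInterior_subset hx).1, fun i hi => ?_⟩
    refine (b.coord i).pos_of_mem_intrinsicInterior (fun z hz => hz.2 i hi) hx (y := b i) ?_ ?_
    · rw [part_zero_eq_convexHull]
      exact subset_convexHull ℝ _ (Set.mem_image_of_mem b hi)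
    · simp
  · rintro x ⟨h0, h1⟩
    have := b.finiteDimensional
    refine mem_intrinsicInterior_of_isOpen (W := {x | ∀ i ∈ A, 0 < b.coord i x}) ?_ h1
      ⟨h0, fun i hi => (h1 i hi).le⟩ ?_
    · simp only [Set.ofPred_forall]
      exact isOpen_biInter_finset fun i _ =>
        isOpen_lt continuous_const (continuous_barycentric_coord b i)
    · rintro y ⟨hy, hy'⟩
      exact ⟨fun i hi => coord_eq_zero_of_mem_affineSpan (fun z hz => hz.1 i hi) hy',
        fun i hi => (hy i hi).le⟩

end AffineBasis

namespace Affine.Simplex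

variable {n : ℕ}

/-- The affine basis formed by the vertices of a full-dimensional simplex. -/
noncomputable def toAffineBasis (s : Affine.Simplex ℝ (EuclideanSpace ℝ (Fin n)) n) :
    AffineBasis (Fin (n + 1)) ℝ (EuclideanSpace ℝ (Fin n)) :=
  ⟨s.points, s.independent,
    s.independent.affineSpan_eq_top_iff_card_eq_finrank_add_one.2 (by simp)⟩

@[simp]
theorem coe_toAffineBasis (s : Affine.Simplex ℝ (EuclideanSpace ℝ (Fin n)) n) :
    ⇑s.toAffineBasis = s.points := rfl

end Affine.Simplex

/-! ### Distances to facets and heights of faces. -/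

namespace Shrunken

open Metric

variable {n : ℕ} {s : Affine.Simplex ℝ (EuclideanSpace ℝ (Fin n)) n}
  {A B : Finset (Fin (n + 1))} {x : EuclideanSpace ℝ (Fin n)} {r : ℝ} {l : ℕ → ℝ}

/-- The residual `L` of the orthogonal projection onto the facet is affine and kills the vertices of
the facet, so in the barycentric expansion of `x` only the term at `i` survives. If the facet is
empty, both distances are `0`. -/
theorem infDist_faceSpan_erase {i : Fin (n + 1)}
    (hx : ∀ j ∉ A, s.toAffineBasis.coord j x = 0) (hxi : 0 ≤ s.toAffineBasis.coord i x) :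
    infDist x (faceSpan s (A.erase i)) =
      s.toAffineBasis.coord i x * infDist (s.points i) (faceSpan s (A.erase i)) := by
  rcases (A.erase i).eq_empty_or_nonempty with he | ⟨j₀, hj₀⟩
  · simp [he, faceSpan]
  · set W := faceSpan s (A.erase i) with hW
    have hmem : ∀ j ∈ A.erase i, s.points j ∈ W := fun j hj =>
      subset_affineSpan ℝ _ (Set.mem_image_of_mem _ hj)
    have : Nonempty W := ⟨⟨_, hmem j₀ hj₀⟩⟩
    let L : EuclideanSpace ℝ (Fin n) →ᵃ[ℝ] EuclideanSpace ℝ (Fin n) :=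
      AffineMap.id ℝ _ - W.subtype.comp
        (EuclideanGeometry.orthogonalProjection W : _ →ᴬ[ℝ] W).toAffineMap
    have hL : ∀ y, infDist y W = ‖L y‖ := fun y => by
      rw [← EuclideanGeometry.dist_orthogonalProjection_eq_infDist, dist_eq_norm]
      rfl
    have hL0 : ∀ j ∈ A.erase i, L (s.points j) = 0 := fun j hj => by
      rw [← norm_eq_zero, ← hL]
      exact infDist_zero_of_mem (hmem j hj)
    have hLx : L x = s.toAffineBasis.coord i x • L (s.points i) := by
      conv_lhs => rw [← s.toAffineBasis.affineCombination_coord_eq_self x]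
      have h1 := s.toAffineBasis.sum_coord_apply_eq_one x
      rw [Finset.map_affineCombination _ _ _ h1,
        Finset.affineCombination_eq_linear_combination _ _ _ h1, Finset.sum_eq_single i]
      · rfl
      · intro j _ hj
        by_cases hjA : j ∈ A
        · rw [Function.comp_apply, Affine.Simplex.coe_toAffineBasis,
            hL0 j (Finset.mem_erase.2 ⟨hj, hjA⟩), smul_zero]
        · rw [hx j hjA, zero_smul]
      · simp
    rw [hL, hL, hLx, norm_smul, Real.norm_of_nonneg hxi]

theorem exists_perm_map_erase {α : Type*} [Fintype α] [DecidableEq α] {A B : Finset α} {i j : α}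
    (hi : i ∈ A) (hj : j ∈ B) (h : A.card = B.card) :
    ∃ σ : Equiv.Perm α, σ i = j ∧ (A.erase i).image σ = B.erase j := by
  have hc : (A.erase i).card = (B.erase j).card := by
    rw [Finset.card_erase_of_mem hi, Finset.card_erase_of_mem hj, h]
  let e : {x // x ∈ A.erase i} ≃ {x // x ∈ B.erase j} := Finset.equivOfCardEq hc
  let τ : Equiv.Perm α := e.extendSubtype
  have hτ : ∀ k ∈ A.erase i, τ k ∈ B.erase j := fun k hk => e.extendSubtype_mem k hk
  -- The swap corrects the image of `i` and fixes every `τ k` with `k ∈ A.erase i`, which differs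
  -- from both `τ i` and `j`.
  refine ⟨τ.trans (Equiv.swap (τ i) j), by simp, ?_⟩
  refine Finset.eq_of_subset_of_card_le ?_ ?_
  · intro k hk
    obtain ⟨k', hk', rfl⟩ := Finset.mem_image.1 hk
    have h1 := hτ k' hk'
    rw [Equiv.trans_apply, Equiv.swap_apply_of_ne_of_ne]
    · exact h1
    · exact fun h => (Finset.mem_erase.1 hk').1 (τ.injective h)
    · exact (Finset.mem_erase.1 h1).1
  · rw [Finset.card_image_of_injective _ (Equiv.injective _), hc]

/-- Regularity realizes each permutation of the vertices by an isometry, which here carries one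
vertex and opposite facet to the other. -/
theorem infDist_vertex_eq (hs : s.Regular) {i j : Fin (n + 1)} (hi : i ∈ A) (hj : j ∈ B)
    (h : A.card = B.card) :
    infDist (s.points i) (faceSpan s (A.erase i)) =
      infDist (s.points j) (faceSpan s (B.erase j)) := by
  obtain ⟨σ, hσ, hσ'⟩ := exists_perm_map_erase hi hj h
  obtain ⟨f, hf⟩ := hs σ
  have hf' : ∀ k, f (s.points k) = s.points (σ k) := fun k => (congrFun hf k).symm
  rw [← infDist_image f.isometry, hf', hσ]
  congr 1
  rw [← f.coeFn_toRealAffineIsometryEquiv]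
  have := AffineSubspace.map_span f.toRealAffineIsometryEquiv.toAffineEquiv.toAffineMap
    (s.points '' (A.erase i))
  have h2 := congrArg (fun S : AffineSubspace ℝ _ => (S : Set (EuclideanSpace ℝ (Fin n)))) this
  refine h2.trans ?_
  rw [faceSpan, ← hσ', Finset.coe_image, Set.image_image, Set.image_image]
  congr 2
  ext y
  simp [hf']

/-- The height of the faces with `m` vertices of a regular simplex. -/
theorem exists_height (hs : s.Regular) :
    ∃ h : ℕ → ℝ, (∀ A : Finset (Fin (n + 1)), ∀ i ∈ A,
      infDist (s.points i) (faceSpan s (A.erase i)) = h A.card) ∧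
      (∀ m, 2 ≤ m → m ≤ n + 1 → 0 < h m) ∧ h 1 = 0 := by
  classical
  let h : ℕ → ℝ := fun m =>
    if H : ∃ p : Finset (Fin (n + 1)) × Fin (n + 1), p.2 ∈ p.1 ∧ p.1.card = m then
      infDist (s.points H.choose.2) (faceSpan s (H.choose.1.erase H.choose.2)) else 0
  have hh : ∀ A : Finset (Fin (n + 1)), ∀ i ∈ A,
      infDist (s.points i) (faceSpan s (A.erase i)) = h A.card := by
    intro A i hi
    have H : ∃ p : Finset (Fin (n + 1)) × Fin (n + 1), p.2 ∈ p.1 ∧ p.1.card = A.card :=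
      ⟨(A, i), hi, rfl⟩
    simp only [h, dif_pos H]
    exact infDist_vertex_eq hs hi H.choose_spec.1 H.choose_spec.2.symm
  refine ⟨h, hh, fun m hm hmn => ?_, ?_⟩
  · obtain ⟨A, -, hA⟩ := Finset.exists_subset_card_eq
      (s := (Finset.univ : Finset (Fin (n + 1)))) (n := m) (by simpa using hmn)
    obtain ⟨i, hi, j, hj, hij⟩ := Finset.one_lt_card.1 (by omega : 1 < A.card)
    rw [← hA, ← hh A i hi]
    have hne : (faceSpan s (A.erase i) : Set (EuclideanSpace ℝ (Fin n))).Nonempty :=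
      ⟨_, subset_affineSpan ℝ _ (Set.mem_image_of_mem _ (Finset.mem_erase.2 ⟨hij.symm, hj⟩))⟩
    refine ((AffineSubspace.closed_of_finiteDimensional _).notMem_iff_infDist_pos hne).1 ?_
    intro hmem
    have h0 : s.toAffineBasis.coord i (s.points i) = 0 := by
      refine AffineBasis.coord_eq_zero_of_mem_affineSpan ?_ hmem
      rintro _ ⟨k, hk, rfl⟩
      exact s.toAffineBasis.coord_apply_ne (Finset.mem_erase.1 hk).1.symm
    have h1 : s.toAffineBasis.coord i (s.points i) = 1 := s.toAffineBasis.coord_apply_eq i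
    linarith
  · have := hh {0} 0 (by simp)
    simpa [faceSpan] using this.symm

theorem face_eq_part : face s A = s.toAffineBasis.part A 0 :=
  (AffineBasis.part_zero_eq_convexHull (b := s.toAffineBasis)).symm

theorem mem_psi {t : Finset (Fin (n + 1))} : x ∈ psi s t ↔
    (∀ i ∈ t, s.toAffineBasis.coord i x = 0) ∧ ∀ i ∉ t, 0 < s.toAffineBasis.coord i x := by
  rw [psi, face_eq_part, AffineBasis.intrinsicInterior_part_zero]
  simp

theorem coord_center (i : Fin (n + 1)) :
    s.toAffineBasis.coord i (center s) = ((n : ℝ) + 1)⁻¹ := by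
  have := s.toAffineBasis.coord_apply_centroid (Finset.mem_univ i)
  simpa [center] using this

theorem shrink_empty : shrink s ∅ r = ∅ := by
  simp [shrink, face]

theorem shrink_eq_part {h : ℕ → ℝ}
    (hh : ∀ A : Finset (Fin (n + 1)), ∀ i ∈ A,
      infDist (s.points i) (faceSpan s (A.erase i)) = h A.card)
    (hpos : ∀ m, 2 ≤ m → m ≤ n + 1 → 0 < h m) (hr : 0 ≤ r) (hr' : A.card = 1 → r = 0) :
    shrink s A r = s.toAffineBasis.part A (r / h A.card) := by
  rcases A.eq_empty_or_nonempty with rfl | hA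
  · exact shrink_empty.trans AffineBasis.part_empty.symm
  have key : ∀ x ∈ face s A, ∀ i ∈ A, (r ≤ infDist x (faceSpan s (A.erase i)) ↔
      r / h A.card ≤ s.toAffineBasis.coord i x) := by
    intro x hx i hi
    rw [face_eq_part] at hx
    rw [infDist_faceSpan_erase hx.1 (hx.2 i hi), hh A i hi]
    have hA1 : 1 ≤ A.card := Finset.card_pos.2 ⟨i, hi⟩
    rcases hA1.eq_or_lt with h1 | h1
    · have h0 : h A.card = 0 := by
        rw [← hh A i hi]
        obtain ⟨k, rfl⟩ := Finset.card_eq_one.1 h1.symm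
        simp [Finset.mem_singleton.1 hi, faceSpan]
      -- For a single vertex `r = 0` and the height is `0`, so the bound `r / 0` is `0`, as
      -- required.
      simp [hr' h1.symm, h0, hx.2 i hi]
    · rw [div_le_iff₀ (hpos _ h1 (by simpa using A.card_le_univ))]
  have h0 : 0 ≤ r / h A.card := by
    rcases le_or_gt 2 A.card with h2 | h2
    · exact div_nonneg hr (hpos _ h2 (by simpa using A.card_le_univ)).le
    · have := hA.card_pos
      simp [hr' (by omega)]
  ext x
  constructor
  · rintro ⟨hx, hx'⟩
    exact ⟨(face_eq_part ▸ hx : x ∈ s.toAffineBasis.part A 0).1,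
      fun i hi => (key x hx i hi).1 (hx' i hi)⟩
  · intro hx
    have hf : x ∈ face s A := by
      rw [face_eq_part]
      exact AffineBasis.part_anti h0 hx
    exact ⟨hf, fun i hi => (key x hf i hi).2 (hx.2 i hi)⟩

end Shrunken

/-! ### Admissible sequences as coordinate thresholds. -/

namespace Shrunken

variable {n : ℕ} {s : Affine.Simplex ℝ (EuclideanSpace ℝ (Fin n)) n}
  {A B C : Finset (Fin (n + 1))} {x : EuclideanSpace ℝ (Fin n)} {r : ℝ} {l : ℕ → ℝ} {μ : ℕ → ℝ}

theorem isSmall_iff {h : ℕ → ℝ}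
    (hh : ∀ A : Finset (Fin (n + 1)), ∀ i ∈ A,
      Metric.infDist (s.points i) (faceSpan s (A.erase i)) = h A.card) :
    IsSmall s r ↔ 0 < r ∧ r < h (n + 1) / (n + 1) := by
  have key : ∀ i, Metric.infDist (center s) (faceSpan s (Finset.univ.erase i)) =
      h (n + 1) / (n + 1) := fun i => by
    rw [infDist_faceSpan_erase (by simp) (by rw [coord_center]; positivity), coord_center,
      hh _ i (Finset.mem_univ i), Finset.card_univ, Fintype.card_fin, inv_mul_eq_div]
  simp only [IsSmall, key, forall_const]

/-- The bounds on the barycentric coordinates that describe the sets `P_A`, by the size of `A`. -/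
structure IsThreshold (s : Affine.Simplex ℝ (EuclideanSpace ℝ (Fin n)) n) (l μ : ℕ → ℝ) :
    Prop where
  P_eq : ∀ A, P s l A = s.toAffineBasis.part A (μ A.card)
  one : μ 1 = 0
  pos : ∀ m, 2 ≤ m → m ≤ n + 1 → 0 < μ m
  mul_lt_one : ∀ m, m ≤ n + 1 → μ m * m < 1
  mono : ∀ m m', 1 ≤ m → m ≤ m' → m' ≤ n + 1 → μ m ≤ μ m'

/-- Monotonicity is read off at a vertex `q i` of `P_A`: for a third index `k`, its `k`-th
coordinate is exactly `μ (m + 1)`, whereas both shrunken facets in the admissibility condition have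
`k`-th coordinate at least `μ m`. -/
theorem IsShrinkSeq.exists_isThreshold (hs : s.Regular) (hl : IsShrinkSeq s l) :
    ∃ μ, IsThreshold s l μ := by
  obtain ⟨h, hh, hpos, h1⟩ := exists_height hs
  have hl0 : ∀ k ≤ n, 0 ≤ l k := fun k hk => by
    rcases hk.eq_or_lt with rfl | hk
    · exact hl.last.ge
    · exact (hl.pos k hk).le
  have hshr : ∀ A : Finset (Fin (n + 1)), ∀ k, A.card + k = n + 1 →
      shrink s A (l k) = s.toAffineBasis.part A (l (n + 1 - A.card) / h A.card) := by
    intro A k hk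
    rcases A.eq_empty_or_nonempty with rfl | hA
    · exact shrink_empty.trans AffineBasis.part_empty.symm
    · have := hA.card_pos
      rw [shrink_eq_part hh hpos (hl0 _ (by omega)), show n + 1 - A.card = k by omega]
      intro hc
      rw [show k = n by omega, hl.last]
  set μ : ℕ → ℝ := fun m => l (n + 1 - m) / h m with hμ
  have hμ1 : μ 1 = 0 := by simp [hμ, h1]
  have hμpos : ∀ m, 2 ≤ m → m ≤ n + 1 → 0 < μ m := fun m hm hm' =>
    div_pos (hl.pos _ (by omega)) (hpos m hm hm')
  have hstep : ∀ m, 2 ≤ m → m + 1 ≤ n + 1 → μ (m + 1) * (m + 1 : ℕ) < 1 → μ m ≤ μ (m + 1) := by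
    intro m hm hmn hlt
    obtain ⟨A, -, hA⟩ := Finset.exists_subset_card_eq
      (s := (Finset.univ : Finset (Fin (n + 1)))) (n := m + 1) (by simpa using hmn)
    obtain ⟨i, j, k, hi, hj, hk, hij, hik, hjk⟩ := Finset.two_lt_card_iff.1
      (by omega : 2 < A.card)
    obtain ⟨q, hq, hq', -⟩ := AffineBasis.exists_finite_part_eq_convexHull
      (b := s.toAffineBasis) (A := A) (c := μ (m + 1)) (by rw [hA]; exact hlt)
    have hqi := hq i hi
    have hsub := hl.step (n - m) (by omega) A (by omega) i hi j hj hij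
    rw [hshr A _ (by omega), hA] at hsub
    have hqT := intrinsicInterior_subset (hsub hqi)
    have hci : (A.erase i).card = m := by rw [Finset.card_erase_of_mem hi, hA]; rfl
    have hcj : (A.erase j).card = m := by rw [Finset.card_erase_of_mem hj, hA]; rfl
    rw [hshr _ _ (by omega), hshr _ _ (by omega), hci, hcj] at hqT
    rw [← hq' i hi k hk hik.symm]
    have hconv : Convex ℝ {x | μ m ≤ s.toAffineBasis.coord k x} := by
      have := (convex_Ici (μ m)).affine_preimage (s.toAffineBasis.coord k)
      exact this
    refine convexHull_min ?_ hconv hqT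
    rintro y (hy | hy)
    · exact hy.2 k (Finset.mem_erase.2 ⟨hik.symm, hk⟩)
    · exact hy.2 k (Finset.mem_erase.2 ⟨hjk.symm, hk⟩)
  have hlt : ∀ m, m ≤ n + 1 → μ m * m < 1 := by
    intro m hm
    rcases lt_or_ge m 2 with h2 | h2
    · interval_cases m <;> simp [hμ1]
    -- Nondegeneracy descends from `m = n + 1`, where it is the smallness of `l 0`; `hstep` itself
    -- needs it one level up.
    · induction hm using Nat.decreasingInduction with
      | self =>
        have := (isSmall_iff hh).1 (hl.small (by omega))
        have hp := hpos (n + 1) h2 le_rfl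
        simp only [hμ, Nat.sub_self]
        rw [div_mul_eq_mul_div, div_lt_one hp]
        have h3 := (lt_div_iff₀ (by positivity)).1 this.2
        push_cast
        exact h3
      | of_succ m hm ih =>
        have ih' := ih (by omega)
        have hle := hstep m h2 hm ih'
        have hp := hμpos (m + 1) (by omega) hm
        push_cast at ih'
        have : μ m * m ≤ μ (m + 1) * m := mul_le_mul_of_nonneg_right hle (by positivity)
        linarith
  refine ⟨μ, fun A => ?_, hμ1, hμpos, hlt, fun m m' hm hmm' hm' => ?_⟩
  · rcases A.eq_empty_or_nonempty with rfl | hA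
    · exact shrink_empty.trans AffineBasis.part_empty.symm
    · have : A.card ≤ n + 1 := by simpa using A.card_le_univ
      exact hshr A _ (by omega)
  · induction m', hmm' using Nat.le_induction with
    | base => exact le_rfl
    | succ k hk ih =>
      refine (ih (by omega)).trans ?_
      -- Admissibility says nothing about the passage from `1` to `2`, but there `μ 1 = 0`.
      rcases hm.eq_or_lt with rfl | hm1
      · rcases hk.eq_or_lt with rfl | hk1
        · rw [hμ1]; exact (hμpos 2 le_rfl hm').le
        · exact hstep k hk1 hm' (hlt _ hm')
      · exact hstep k (by omega) hm' (hlt _ hm')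

/-- Multiplying by the heights makes the coordinate thresholds `ρ / 2 ^ k`. Their strict decrease
leaves the room needed for relative interiors. -/
theorem exists_isShrinkSeq (hs : s.Regular) (hr : 0 < n → IsSmall s r) :
    ∃ l : ℕ → ℝ, IsShrinkSeq s l ∧ (0 < n → l 0 = r) := by
  obtain ⟨h, hh, hpos, h1⟩ := exists_height hs
  set l : ℕ → ℝ := fun k => if k < n then h (n + 1 - k) * (r / h (n + 1)) / 2 ^ k else 0 with hl
  have hr0 : 0 < n → 0 < r / h (n + 1) := fun hn =>
    div_pos (hr hn).1 (hpos _ (by omega) le_rfl)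
  have hlpos : ∀ k < n, 0 < l k := fun k hk => by
    simp only [hl, if_pos hk]
    have := hpos (n + 1 - k) (by omega) (by omega)
    have := hr0 (by omega)
    positivity
  have hl0 : 0 < n → l 0 = r := fun hn => by
    have := (hpos (n + 1) (by omega) le_rfl).ne'
    simp only [hl, if_pos hn, Nat.sub_zero, pow_zero, div_one]
    field_simp
  refine ⟨l, ⟨hlpos, by simp [hl], fun hn => by rw [hl0 hn]; exact hr hn, ?_⟩, hl0⟩
  intro k hk A hA i hi j hj hij x hx
  have hρ := hr0 (by omega)
  set ρ := r / h (n + 1) with hρd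
  have hci : (A.erase i).card = n - k := by rw [Finset.card_erase_of_mem hi]; omega
  have hcj : (A.erase j).card = n - k := by rw [Finset.card_erase_of_mem hj]; omega
  have hshr : ∀ m, m < n → ∀ B : Finset (Fin (n + 1)), B.card = n + 1 - m →
      shrink s B (l m) = s.toAffineBasis.part B (ρ / 2 ^ m) := by
    intro m hm B hB
    rw [shrink_eq_part hh hpos (hlpos m hm).le (by omega), hB]
    have := (hpos (n + 1 - m) (by omega) (by omega)).ne'
    simp only [hl, if_pos hm]
    congr 1
    field_simp
  rw [hshr k (by omega) A (by omega)] at hx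
  rw [hshr (k + 1) hk _ (by omega), hshr (k + 1) hk _ (by omega)]
  have hc : (0 : ℝ) < ρ / 2 ^ (k + 1) := by positivity
  have hlt : ρ / 2 ^ (k + 1) < ρ / 2 ^ k := by
    rw [pow_succ, ← div_div]
    exact half_lt_self (by positivity)
  have hAij : A.erase i ∪ A.erase j = A := by
    ext a
    simp only [Finset.mem_union, Finset.mem_erase]
    refine ⟨by tauto, fun ha => ?_⟩
    by_cases hai : a = i
    · exact Or.inr ⟨hai ▸ hij, ha⟩
    · exact Or.inl ⟨hai, ha⟩
  have hsub := AffineBasis.part_union_subset (b := s.toAffineBasis) hc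
    (A := A.erase i) (B := A.erase j)
    (fun H => by simpa using H (Finset.mem_erase.2 ⟨hij.symm, hj⟩))
    (fun H => by simpa using H (Finset.mem_erase.2 ⟨hij, hi⟩))
  rw [hAij] at hsub
  refine mem_intrinsicInterior_of_isOpen
    (W := {y | ∀ a ∈ A, ρ / 2 ^ (k + 1) < s.toAffineBasis.coord a y}) ?_
    (fun a ha => hlt.trans_le (hx.2 a ha)) (hsub (AffineBasis.part_anti hlt.le hx)) ?_
  · simp only [Set.ofPred_forall]
    exact isOpen_biInter_finset fun a _ =>
      isOpen_lt continuous_const (continuous_barycentric_coord _ a)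
  · rintro y ⟨hy, hy'⟩
    rw [affineSpan_convexHull] at hy'
    refine hsub ⟨fun a ha => AffineBasis.coord_eq_zero_of_mem_affineSpan ?_ hy',
      fun a ha => (hy a ha).le⟩
    rintro z (hz | hz)
    · exact hz.1 a fun h => ha (Finset.mem_of_mem_erase h)
    · exact hz.1 a fun h => ha (Finset.mem_of_mem_erase h)

/-! ### The points of `X` and their supports. -/

namespace IsThreshold

theorem coord_pos (h : IsThreshold s l μ) (hx : x ∈ P s l A) {i : Fin (n + 1)} (hi : i ∈ A) :
    0 < s.toAffineBasis.coord i x := by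
  rw [h.P_eq] at hx
  have hc : 0 < A.card := Finset.card_pos.2 ⟨i, hi⟩
  -- The threshold of a vertex is only `0`, but its single coordinate is `1`.
  rcases lt_or_ge A.card 2 with h2 | h2
  · obtain ⟨j, rfl⟩ := Finset.card_eq_one.1 (by omega : A.card = 1)
    have := AffineBasis.sum_coord_of_mem_part hx
    rw [Finset.mem_singleton.1 hi]
    simp at this
    rw [this]; norm_num
  · exact (h.pos _ h2 (by simpa using A.card_le_univ)).trans_le (hx.2 i hi)

theorem coord_eq_zero (h : IsThreshold s l μ) (hx : x ∈ P s l A) {i : Fin (n + 1)} (hi : i ∉ A) :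
    s.toAffineBasis.coord i x = 0 := by
  rw [h.P_eq] at hx
  exact hx.1 i hi

theorem mem_phi_iff (h : IsThreshold s l μ) (hx : x ∈ P s l A) (S : MeetSub (Finset (Fin (n + 1)))) :
    x ∈ phi s S ↔ Aᶜ ∈ S.1 := by
  simp only [phi, Set.mem_iUnion, exists_prop, mem_psi]
  constructor
  · rintro ⟨t, ht, h0, hpos⟩
    have : t = Aᶜ := by
      ext i
      rw [Finset.mem_compl]
      constructor
      · intro hi hiA
        exact (h.coord_pos hx hiA).ne' (h0 i hi)
      · intro hiA
        by_contra hi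
        exact (hpos i hi).ne' (h.coord_eq_zero hx hiA)
    rwa [← this]
  · intro hA
    exact ⟨Aᶜ, hA, fun i hi => h.coord_eq_zero hx (Finset.mem_compl.1 hi),
      fun i hi => h.coord_pos hx (by simpa using hi)⟩

theorem card_mul_lt (h : IsThreshold s l μ) (A : Finset (Fin (n + 1))) : μ A.card * A.card < 1 :=
  h.mul_lt_one _ (by simpa using A.card_le_univ)

theorem center_mem (h : IsThreshold s l μ) : center s ∈ P s l Finset.univ := by
  rw [h.P_eq]
  refine ⟨by simp, fun i _ => ?_⟩
  rw [coord_center, Finset.card_univ, Fintype.card_fin, ← one_div, le_div_iff₀ (by positivity)]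
  exact_mod_cast (h.mul_lt_one (n + 1) le_rfl).le

theorem exists_mem_P (h : IsThreshold s l μ) (hx : x ∈ X s l) : ∃ A, x ∈ P s l A := by
  rcases hx with rfl | hx
  · exact ⟨_, h.center_mem⟩
  · simp only [Set.mem_iUnion] at hx
    obtain ⟨A, -, hx⟩ := hx
    exact ⟨A, extremePoints_subset hx⟩

theorem extremePoints_subset_X (hA : A ≠ Finset.univ) : (P s l A).extremePoints ℝ ⊆ X s l :=
  fun _ hx => Or.inr (Set.mem_biUnion (x := A) (Finset.ssubset_univ_iff.2 hA) hx)

theorem finite_X (h : IsThreshold s l μ) : (X s l).Finite := by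
  refine (Set.finite_singleton _).union (Set.Finite.biUnion (Set.toFinite _) fun A _ => ?_)
  rw [h.P_eq]
  exact AffineBasis.finite_extremePoints_part (h.card_mul_lt A)

theorem exists_mem_X (h : IsThreshold s l μ) (hA : A.Nonempty) : ∃ x ∈ X s l, x ∈ P s l A := by
  by_cases hA' : A = Finset.univ
  · subst hA'
    exact ⟨_, Or.inl rfl, h.center_mem⟩
  · have := AffineBasis.nonempty_extremePoints_part (b := s.toAffineBasis) (h.card_mul_lt A) hA
    rw [← h.P_eq] at this
    obtain ⟨x, hx⟩ := this
    exact ⟨x, extremePoints_subset_X hA' hx, extremePoints_subset hx⟩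

/-- `part_union_subset` is applied with the threshold of `A ∪ B`, which by monotonicity dominates
those of `A` and `B`. -/
theorem P_union_subset (h : IsThreshold s l μ) (hAB : ¬ A ⊆ B) (hBA : ¬ B ⊆ A) :
    P s l (A ∪ B) ⊆ convexHull ℝ ((P s l A).extremePoints ℝ ∪ (P s l B).extremePoints ℝ) := by
  have hcard : (A ∪ B).card ≤ n + 1 := by simpa using (A ∪ B).card_le_univ
  have hA : A.Nonempty := Finset.nonempty_iff_ne_empty.2 fun h => hAB (by simp [h])
  have hB : B.Nonempty := Finset.nonempty_iff_ne_empty.2 fun h => hBA (by simp [h])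
  have hlt : A.card < (A ∪ B).card := Finset.card_lt_card <|
    Finset.subset_union_left.ssubset_of_ne fun h => hBA (by rw [h]; exact Finset.subset_union_right)
  have hle : B.card ≤ (A ∪ B).card := Finset.card_le_card Finset.subset_union_right
  have := hA.card_pos
  have hmem : ∀ D : Finset (Fin (n + 1)), D.Nonempty → D.card ≤ (A ∪ B).card →
      s.toAffineBasis.part D (μ (A ∪ B).card) ⊆ convexHull ℝ ((P s l D).extremePoints ℝ) := by
    intro D hD hDle
    rw [h.P_eq, AffineBasis.convexHull_extremePoints_part (h.card_mul_lt D)]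
    exact AffineBasis.part_anti (h.mono _ _ hD.card_pos hDle hcard)
  rw [h.P_eq]
  refine (AffineBasis.part_union_subset (h.pos _ (by omega) hcard) hAB hBA).trans
    (convexHull_min (Set.union_subset ?_ ?_) (convex_convexHull ℝ _))
  · exact (hmem A hA hlt.le).trans (convexHull_mono Set.subset_union_left)
  · exact (hmem B hB hle).trans (convexHull_mono Set.subset_union_right)

end IsThreshold

/-! ### Convexity of `φ(S)`, joins, meets and injectivity. -/

/-- A proper convex combination of points with nonnegative coordinates has a zero coordinate exactly
where both points do, so points of `ψ(t)` and `ψ(u)` combine into `ψ(t ∩ u)`. -/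
theorem convex_phi (S : MeetSub (Finset (Fin (n + 1)))) : Convex ℝ (phi s S) := by
  intro x hx y hy a b ha hb hab
  rcases ha.eq_or_lt with rfl | ha
  · rw [zero_add] at hab; subst hab; simpa using hy
  rcases hb.eq_or_lt with rfl | hb
  · rw [add_zero] at hab; subst hab; simpa using hx
  simp only [phi, Set.mem_iUnion, exists_prop, mem_psi] at hx hy ⊢
  obtain ⟨t, ht, hx0, hxp⟩ := hx
  obtain ⟨u, hu, hy0, hyp⟩ := hy
  refine ⟨t ⊓ u, S.2.2 ht hu, fun i hi => ?_, fun i hi => ?_⟩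
  · rw [Finset.inf_eq_inter, Finset.mem_inter] at hi
    rw [AffineBasis.coord_combo hab, hx0 i hi.1, hy0 i hi.2]; simp
  · rw [AffineBasis.coord_combo hab]
    have hx' : 0 ≤ s.toAffineBasis.coord i x := by
      by_cases h : i ∈ t
      · exact (hx0 i h).ge
      · exact (hxp i h).le
    have hy' : 0 ≤ s.toAffineBasis.coord i y := by
      by_cases h : i ∈ u
      · exact (hy0 i h).ge
      · exact (hyp i h).le
    by_cases h : i ∈ t
    · have : 0 < s.toAffineBasis.coord i y := hyp i fun h' => hi (Finset.mem_inter.2 ⟨h, h'⟩)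
      positivity
    · have := hxp i h
      positivity

theorem phi_inter_X_mem (S : MeetSub (Finset (Fin (n + 1)))) :
    phi s S ∩ X s l = convexHull ℝ (phi s S ∩ X s l) ∩ X s l := by
  apply Set.Subset.antisymm
  · exact fun x hx => ⟨subset_convexHull ℝ _ hx, hx.2⟩
  · exact fun x hx => ⟨convexHull_min Set.inter_subset_left (convex_phi S) hx.1, hx.2⟩

theorem IsThreshold.phi_inter_X_sup (h : IsThreshold s l μ)
    (S T : MeetSub (Finset (Fin (n + 1)))) :
    phi s (S ⊔ T) ∩ X s l =
      convexHull ℝ ((phi s S ∩ X s l) ∪ (phi s T ∩ X s l)) ∩ X s l := by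
  have hmono : ∀ {S T : MeetSub (Finset (Fin (n + 1)))}, S ≤ T → phi s S ⊆ phi s T :=
    fun hST => Set.biUnion_subset_biUnion_left hST
  apply Set.Subset.antisymm
  · rintro x ⟨hx, hxX⟩
    refine ⟨?_, hxX⟩
    obtain ⟨C, hxC⟩ := h.exists_mem_P hxX
    obtain ⟨a, ha, b, hb, hab⟩ := (h.mem_phi_iff hxC _).1 hx
    have hC : C = aᶜ ∪ bᶜ := by
      rw [← Finset.compl_inter, ← Finset.inf_eq_inter, hab, compl_compl]
    by_cases hAB : aᶜ ⊆ bᶜ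
    · rw [Finset.union_eq_right.2 hAB] at hC
      refine subset_convexHull ℝ _ (Or.inr ⟨(h.mem_phi_iff hxC _).2 ?_, hxX⟩)
      rwa [hC, compl_compl]
    by_cases hBA : bᶜ ⊆ aᶜ
    · rw [Finset.union_eq_left.2 hBA] at hC
      refine subset_convexHull ℝ _ (Or.inl ⟨(h.mem_phi_iff hxC _).2 ?_, hxX⟩)
      rwa [hC, compl_compl]
    rw [hC] at hxC
    -- Incomparable sets are both proper, so their extreme points belong to `X`.
    refine convexHull_mono (Set.union_subset_union ?_ ?_) (h.P_union_subset hAB hBA hxC)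
    · refine fun y hy => ⟨(h.mem_phi_iff (extremePoints_subset hy) S).2 (by rwa [compl_compl]), ?_⟩
      exact IsThreshold.extremePoints_subset_X (fun H => hBA (by rw [H]; exact Finset.subset_univ _)) hy
    · refine fun y hy => ⟨(h.mem_phi_iff (extremePoints_subset hy) T).2 (by rwa [compl_compl]), ?_⟩
      exact IsThreshold.extremePoints_subset_X (fun H => hAB (by rw [H]; exact Finset.subset_univ _)) hy
  · rintro x ⟨hx, hxX⟩
    refine ⟨convexHull_min ?_ (convex_phi _) hx, hxX⟩
    rintro y (hy | hy)
    · exact hmono le_sup_left hy.1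
    · exact hmono le_sup_right hy.1

theorem IsThreshold.phi_inter_X_inf (h : IsThreshold s l μ)
    (S T : MeetSub (Finset (Fin (n + 1)))) :
    phi s (S ⊓ T) ∩ X s l = (phi s S ∩ X s l) ∩ (phi s T ∩ X s l) := by
  ext x
  constructor
  · rintro ⟨hx, hxX⟩
    obtain ⟨C, hxC⟩ := h.exists_mem_P hxX
    have := (h.mem_phi_iff hxC _).1 hx
    exact ⟨⟨(h.mem_phi_iff hxC _).2 this.1, hxX⟩, ⟨(h.mem_phi_iff hxC _).2 this.2, hxX⟩⟩
  · rintro ⟨⟨hx, hxX⟩, hx', -⟩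
    obtain ⟨C, hxC⟩ := h.exists_mem_P hxX
    exact ⟨(h.mem_phi_iff hxC _).2
      ⟨(h.mem_phi_iff hxC _).1 hx, (h.mem_phi_iff hxC _).1 hx'⟩, hxX⟩

theorem IsThreshold.le_of_phi_inter_X_subset (h : IsThreshold s l μ)
    {S T : MeetSub (Finset (Fin (n + 1)))} (hST : phi s S ∩ X s l ⊆ phi s T) : S ≤ T := by
  intro t ht
  -- For `t = ⊤` the set `ψ(t)` is empty and yields no witness, but every `T` contains `⊤`.
  rcases (tᶜ).eq_empty_or_nonempty with he | hne
  · rw [(Finset.compl_eq_empty_iff t).1 he]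
    exact T.2.1
  · obtain ⟨x, hxX, hx⟩ := h.exists_mem_X hne
    have := (h.mem_phi_iff hx T).1 (hST ⟨(h.mem_phi_iff hx S).2 (by rwa [compl_compl]), hxX⟩)
    rwa [compl_compl] at this

end Shrunken

theorem mainTheorem4 (n : ℕ) (s : Affine.Simplex ℝ (EuclideanSpace ℝ (Fin n)) n)
    (hs : s.Regular) :
    (∀ r : ℝ, (0 < n → Shrunken.IsSmall s r) →
      ∃ l : ℕ → ℝ, Shrunken.IsShrinkSeq s l ∧ (0 < n → l 0 = r)) ∧
    ∀ l : ℕ → ℝ, Shrunken.IsShrinkSeq s l →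
      (Shrunken.X s l).Finite ∧
      ∃ f : LatticeHom (MeetSub (Finset (Fin (n + 1)))) (RelConvex (Shrunken.X s l)),
        Function.Injective f ∧
        ∀ S, (f S).1 = Shrunken.phi s S ∩ Shrunken.X s l := by
  refine ⟨fun r hr => Shrunken.exists_isShrinkSeq hs hr, fun l hl => ?_⟩
  obtain ⟨μ, h⟩ := hl.exists_isThreshold hs
  refine ⟨h.finite_X, ⟨⟨⟨fun S => ⟨_, Shrunken.phi_inter_X_mem S⟩, fun S T => ?_⟩, fun S T => ?_⟩,
    fun S T hST => ?_, fun S => rfl⟩⟩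
  · exact Subtype.ext (h.phi_inter_X_sup S T)
  · exact Subtype.ext (h.phi_inter_X_inf S T)
  · have hST' : Shrunken.phi s S ∩ Shrunken.X s l = Shrunken.phi s T ∩ Shrunken.X s l :=
      congrArg Subtype.val hST
    exact le_antisymm (h.le_of_phi_inter_X_subset (hST'.subset.trans Set.inter_subset_left))
      (h.le_of_phi_inter_X_subset (hST'.superset.trans Set.inter_subset_left))
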